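/- Let $k$ be a field and let $A=\bigoplus_{i\ge 0}A_i$ be a left noetherian (in particular, any noetherian) $\mathbb N$-graded $k$-algebra with $\dim_k A_i<\infty$ for all $i$. Let $\mathrm{Gr}\,A$ be the category of $\mathbb Z$-graded left $A$-modules and degree-zero homomorphisms, $\mathbf D(\mathrm{Gr}\,A)$ its derived category, and $\mathbf D^-(\mathrm{gr}\,A)$ the full subcategory of those $X\in\mathbf D(\mathrm{Gr}\,A)$ such that $H^i(X)=0$ for $i\gg 0$ and every $H^i(X)$ is a finitely generated $A$-module. Let $J$ be the graded Jacobson radical of $A$ (the intersection of all maximal homogeneous left ideals) and $S=A/J$. Write $M(j)$ for the graded module with $M(j)_m=M_{m+j}$, and let $R\underline{\mathrm{Hom}}_A$ be the derived functor of graded Hom, so that $H^i(R\underline{\mathrm{Hom}}_A(X,S))_j=\mathrm{Hom}_{\mathbf D(\mathrm{Gr}\,A)}(X,S(j)[i])$. For $X\in\mathbf D(\mathrm{Gr}\,A)$ put $$\mathrm{ideg}(X)=\inf\{i+j\mid H^i(X)_j\neq 0\},\qquad \mathrm{extreg}(X)=\sup\{i+j\mid H^i(R\underline{\mathrm{Hom}}_A(X,S))_j\neq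 0\},$$ both in $\mathbb Z\cup\{\pm\infty\}$ with $i,j\in\mathbb Z$. Then for every $0\neq X\in\mathbf D^-(\mathrm{gr}\,A)$, $$-\mathrm{ideg}(X)\le \mathrm{extreg}(X).$$ If moreover the ring $A_0$ is semisimple, then $\mathrm{extreg}(X)=-\mathrm{ideg}(X)$. -/

import Mathlib

universe w v u

open CategoryTheory Limits

noncomputable section

/-- A graded left module `M = ⨁_{j ∈ ℤ} M_j` over the `ℕ`-graded algebra `A = ⨁_{i ∈ ℕ} A_i`, given by
its homogeneous components `M_j` and the multiplications `A_i × M_j → M_l` for `i + j = l`. -/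
structure GrMod {k : Type v} [Field k] {A : Type u} [Ring A] [Algebra k A]
    (𝒜 : ℕ → Submodule k A) [GradedAlgebra 𝒜] where
  /-- The homogeneous components. -/
  comp : ℤ → Type u
  [addCommGroup : ∀ j, AddCommGroup (comp j)]
  /-- Multiplication `A_i × M_j → M_{i+j}`. -/
  act : ∀ (i : ℕ) (j l : ℤ), (i : ℤ) + j = l → (𝒜 i →+ comp j →+ comp l)
  one_act : ∀ (j : ℤ) (x : comp j),
    act 0 j j (by simp) ⟨1, SetLike.GradedOne.one_mem⟩ x = x
  mul_act : ∀ (i i' : ℕ) (j l l' : ℤ) (h : (i' : ℤ) + j = l) (h' : (i : ℤ) + l = l')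
    (a : 𝒜 i) (b : 𝒜 i') (x : comp j),
    act (i + i') j l' (by push_cast; omega)
      ⟨(a : A) * (b : A), SetLike.GradedMul.mul_mem a.2 b.2⟩ x = act i l l' h' a (act i' j l h b x)

namespace GrMod

variable {k : Type v} [Field k] {A : Type u} [Ring A] [Algebra k A]
  {𝒜 : ℕ → Submodule k A} [GradedAlgebra 𝒜]

attribute [instance] GrMod.addCommGroup

/-- Degree-zero homomorphisms of graded modules. -/
@[ext]
structure Hom (M N : GrMod.{v, u} 𝒜) where
  /-- The homogeneous components of the homomorphism. -/
  app : ∀ j, M.comp j →+ N.comp j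
  map_act : ∀ (i : ℕ) (j l : ℤ) (h : (i : ℤ) + j = l) (a : 𝒜 i) (x : M.comp j),
    app l (M.act i j l h a x) = N.act i j l h a (app j x)

/-- The category `Gr A` of graded modules and degree-zero homomorphisms. -/
instance : Category.{u} (GrMod.{v, u} 𝒜) where
  Hom := Hom
  id M := ⟨fun j => AddMonoidHom.id _, fun _ _ _ _ _ _ => rfl⟩
  comp f g := ⟨fun j => (g.app j).comp (f.app j), fun i j l h a x => by
    simp [f.map_act, g.map_act]⟩

@[ext]
theorem hom_ext {M N : GrMod.{v, u} 𝒜} {f g : M ⟶ N}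
    (h : ∀ j (x : M.comp j), f.app j x = g.app j x) : f = g :=
  Hom.ext (funext fun j => AddMonoidHom.ext (h j))

@[simp]
theorem id_app {M : GrMod.{v, u} 𝒜} (j : ℤ) (x : M.comp j) :
    Hom.app (𝟙 M) j x = x := rfl

@[simp]
theorem comp_app {M N P : GrMod.{v, u} 𝒜} (f : M ⟶ N) (g : N ⟶ P) (j : ℤ) (x : M.comp j) :
    (f ≫ g).app j x = g.app j (f.app j x) := rfl

theorem hom_map_act {M N : GrMod.{v, u} 𝒜} (f : M ⟶ N) (i : ℕ) (j l : ℤ) (h : (i : ℤ) + j = l)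
    (a : 𝒜 i) (x : M.comp j) : f.app l (M.act i j l h a x) = N.act i j l h a (f.app j x) :=
  f.map_act i j l h a x

section Abelian

instance (M N : GrMod.{v, u} 𝒜) : Zero (M ⟶ N) :=
  ⟨⟨fun _ => 0, fun _ _ _ _ _ _ => by simp⟩⟩

instance (M N : GrMod.{v, u} 𝒜) : Add (M ⟶ N) :=
  ⟨fun f g => ⟨fun j => f.app j + g.app j, fun i j l h a x => by
    simp [hom_map_act]⟩⟩

instance (M N : GrMod.{v, u} 𝒜) : Neg (M ⟶ N) :=
  ⟨fun f => ⟨fun j => - f.app j, fun i j l h a x => by simp [hom_map_act]⟩⟩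

@[simp]
theorem zero_app {M N : GrMod.{v, u} 𝒜} (j : ℤ) (x : M.comp j) :
    (0 : M ⟶ N).app j x = 0 := rfl

@[simp]
theorem add_app {M N : GrMod.{v, u} 𝒜} (f g : M ⟶ N) (j : ℤ) (x : M.comp j) :
    (f + g).app j x = f.app j x + g.app j x := rfl

@[simp]
theorem neg_app {M N : GrMod.{v, u} 𝒜} (f : M ⟶ N) (j : ℤ) (x : M.comp j) :
    (-f).app j x = - f.app j x := rfl

instance (M N : GrMod.{v, u} 𝒜) : AddCommGroup (M ⟶ N) where
  add_assoc _ _ _ := by ext; simp [add_assoc]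
  zero_add _ := by ext; simp
  add_zero _ := by ext; simp
  nsmul := nsmulRec
  zsmul := zsmulRec
  neg_add_cancel _ := by ext; simp
  add_comm _ _ := by ext; simp [add_comm]

instance : Preadditive (GrMod.{v, u} 𝒜) where
  add_comp _ _ _ _ _ _ := by ext; simp
  comp_add _ _ _ _ _ _ := by ext; simp

/-- The zero module. -/
def zeroObj : GrMod.{v, u} 𝒜 where
  comp _ := PUnit
  act _ _ _ _ := 0
  one_act _ _ := rfl
  mul_act _ _ _ _ _ _ _ _ _ _ := rfl

instance : HasZeroObject (GrMod.{v, u} 𝒜) :=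
  ⟨zeroObj, by
    rw [IsZero.iff_id_eq_zero]
    ext
    rfl⟩

/-- The direct sum of two graded modules. -/
def prod (M N : GrMod.{v, u} 𝒜) : GrMod.{v, u} 𝒜 where
  comp j := M.comp j × N.comp j
  act i j l h :=
    { toFun := fun a => (M.act i j l h a).prodMap (N.act i j l h a)
      map_zero' := by ext <;> simp
      map_add' := fun _ _ => by ext <;> simp }
  one_act j x := Prod.ext (M.one_act j x.1) (N.one_act j x.2)
  mul_act i i' j l l' h h' a b x :=
    Prod.ext (M.mul_act i i' j l l' h h' a b x.1) (N.mul_act i i' j l l' h h' a b x.2)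

/-- The direct sum is a biproduct. -/
def prodBicone (M N : GrMod.{v, u} 𝒜) : BinaryBicone M N where
  pt := prod M N
  fst := ⟨fun j => AddMonoidHom.fst _ _, fun _ _ _ _ _ _ => rfl⟩
  snd := ⟨fun j => AddMonoidHom.snd _ _, fun _ _ _ _ _ _ => rfl⟩
  inl := ⟨fun j => AddMonoidHom.inl _ _, fun i j l h a x => by
    refine Prod.ext rfl ?_
    exact (map_zero (N.act i j l h a)).symm⟩
  inr := ⟨fun j => AddMonoidHom.inr _ _, fun i j l h a x => by
    refine Prod.ext ?_ rfl
    exact (map_zero (M.act i j l h a)).symm⟩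
  inl_fst := rfl
  inl_snd := rfl
  inr_fst := rfl
  inr_snd := rfl

instance : HasBinaryBiproducts (GrMod.{v, u} 𝒜) where
  has_binary_biproduct M N := HasBinaryBiproduct.mk
    { bicone := prodBicone M N
      isBilimit := isBinaryBilimitOfTotal _ (by
        ext j x
        exact Prod.ext (add_zero x.1) (zero_add x.2)) }

instance : HasFiniteProducts (GrMod.{v, u} 𝒜) :=
  hasFiniteProducts_of_has_binary_and_terminal

/-- The kernel of a homomorphism. -/
def ker {M N : GrMod.{v, u} 𝒜} (f : M ⟶ N) : GrMod.{v, u} 𝒜 where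
  comp j := (f.app j).ker
  act i j l h :=
    { toFun := fun a =>
        ((M.act i j l h a).comp (f.app j).ker.subtype).codRestrict (f.app l).ker (fun x => by
          have hx : f.app j x = 0 := x.2
          simp [AddMonoidHom.mem_ker, hom_map_act, hx])
      map_zero' := AddMonoidHom.ext fun x => Subtype.ext (by simp)
      map_add' := fun a b => AddMonoidHom.ext fun x => Subtype.ext (by
        change M.act i j l h (a + b) x = M.act i j l h a x + M.act i j l h b x
        simp) }
  one_act j x := Subtype.ext (M.one_act j x.1)
  mul_act i i' j l l' h h' a b x := Subtype.ext (M.mul_act i i' j l l' h h' a b x.1)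

/-- The inclusion of the kernel. -/
def kerι {M N : GrMod.{v, u} 𝒜} (f : M ⟶ N) : ker f ⟶ M :=
  ⟨fun j => (f.app j).ker.subtype, fun _ _ _ _ _ _ => rfl⟩

theorem kerι_comp {M N : GrMod.{v, u} 𝒜} (f : M ⟶ N) : kerι f ≫ f = 0 :=
  hom_ext fun _ x => x.2

/-- The factorization of a homomorphism through a kernel. -/
def kerLift {M N P : GrMod.{v, u} 𝒜} (f : M ⟶ N) (g : P ⟶ M) (w : g ≫ f = 0) : P ⟶ ker f :=
  ⟨fun j => (g.app j).codRestrict (f.app j).ker (fun x => by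
      have := congrArg (fun t => Hom.app t j x) w
      exact this), fun i j l h a x => Subtype.ext (hom_map_act g i j l h a x)⟩

instance : HasKernels (GrMod.{v, u} 𝒜) where
  has_limit {M N} f := ⟨⟨⟨KernelFork.ofι (kerι f) (kerι_comp f),
    KernelFork.IsLimit.ofι _ _ (fun g w => kerLift f g w) (fun _ _ => rfl)
      (fun g w m hm => hom_ext fun j x => Subtype.ext (by
        have := congrArg (fun t => Hom.app t j x) hm
        exact this))⟩⟩⟩

/-- The cokernel of a homomorphism. -/
def coker {M N : GrMod.{v, u} 𝒜} (f : M ⟶ N) : GrMod.{v, u} 𝒜 where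
  comp j := N.comp j ⧸ (f.app j).range
  act i j l h :=
    { toFun := fun a => QuotientAddGroup.map _ _ (N.act i j l h a) (by
        rintro _ ⟨x, rfl⟩
        exact ⟨M.act i j l h a x, hom_map_act f i j l h a x⟩)
      map_zero' := by
        ext x
        simp
      map_add' := fun _ _ => by
        ext x
        simp }
  one_act j x := by
    induction x using QuotientAddGroup.induction_on with
    | H x => exact congrArg _ (N.one_act j x)
  mul_act i i' j l l' h h' a b x := by
    induction x using QuotientAddGroup.induction_on with
    | H x => exact congrArg _ (N.mul_act i i' j l l' h h' a b x)

/-- The projection to the cokernel. -/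
def cokerπ {M N : GrMod.{v, u} 𝒜} (f : M ⟶ N) : N ⟶ coker f :=
  ⟨fun _ => QuotientAddGroup.mk' _, fun _ _ _ _ _ _ => rfl⟩

theorem comp_cokerπ {M N : GrMod.{v, u} 𝒜} (f : M ⟶ N) : f ≫ cokerπ f = 0 :=
  hom_ext fun _ x => (QuotientAddGroup.eq_zero_iff _).2 ⟨x, rfl⟩

/-- The factorization of a homomorphism through a cokernel. -/
def cokerDesc {M N P : GrMod.{v, u} 𝒜} (f : M ⟶ N) (g : N ⟶ P) (w : f ≫ g = 0) : coker f ⟶ P :=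
  ⟨fun j => QuotientAddGroup.lift _ (g.app j) (by
      rintro _ ⟨x, rfl⟩
      have := congrArg (fun t => Hom.app t j x) w
      exact this), fun i j l h a x => by
    induction x using QuotientAddGroup.induction_on with
    | H x => exact hom_map_act g i j l h a x⟩

instance : HasCokernels (GrMod.{v, u} 𝒜) where
  has_colimit {M N} f := ⟨⟨⟨CokernelCofork.ofπ (cokerπ f) (comp_cokerπ f),
    CokernelCofork.IsColimit.ofπ _ _ (fun g w => cokerDesc f g w) (fun _ _ => rfl)
      (fun g w m hm => hom_ext fun j x => by
        induction x using QuotientAddGroup.induction_on with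
        | H x =>
          have := congrArg (fun t => Hom.app t j x) hm
          exact this)⟩⟩⟩

theorem injective_of_mono {M N : GrMod.{v, u} 𝒜} (f : M ⟶ N) [Mono f] (j : ℤ) :
    Function.Injective (f.app j) := by
  have h : kerι f = 0 := zero_of_comp_mono f (kerι_comp f)
  rw [injective_iff_map_eq_zero]
  intro x hx
  let x' : (ker f).comp j := (⟨x, hx⟩ : (f.app j).ker)
  exact congrArg (fun t : ker f ⟶ M => t.app j x') h

theorem surjective_of_epi {M N : GrMod.{v, u} 𝒜} (f : M ⟶ N) [Epi f] (j : ℤ) :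
    Function.Surjective (f.app j) := by
  have h : cokerπ f = 0 := zero_of_epi_comp f (comp_cokerπ f)
  intro y
  have hy := congrArg (fun t => Hom.app t j y) h
  exact (QuotientAddGroup.eq_zero_iff y).1 hy

/-- A homomorphism whose components are bijective is an isomorphism. -/
theorem isIso_of_bijective {M N : GrMod.{v, u} 𝒜} (f : M ⟶ N)
    (hf : ∀ j, Function.Bijective (f.app j)) : IsIso f := by
  let e : ∀ j, M.comp j ≃+ N.comp j := fun j => AddEquiv.ofBijective (f.app j) (hf j)
  have he : ∀ j (y : N.comp j), f.app j ((e j).symm y) = y := fun j y => (e j).apply_symm_apply y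
  refine ⟨⟨⟨fun j => (e j).symm.toAddMonoidHom, fun i j l h a x => ?_⟩, ?_, ?_⟩⟩
  · apply (hf l).1
    rw [hom_map_act]
    exact (he l _).trans (by congr 1; exact (he j x).symm)
  · exact hom_ext fun j x => (e j).symm_apply_apply x
  · exact hom_ext fun j x => he j x

instance : IsNormalMonoCategory (GrMod.{v, u} 𝒜) where
  normalMonoOfMono {M N} f _ := by
    let g : M ⟶ ker (cokerπ f) := kerLift (cokerπ f) f (comp_cokerπ f)
    have : IsIso g := isIso_of_bijective g fun j => by
      refine ⟨fun x y hxy => injective_of_mono f j (congrArg Subtype.val hxy), fun y => ?_⟩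
      obtain ⟨x, hx⟩ := (QuotientAddGroup.eq_zero_iff y.1).1 y.2
      exact ⟨x, Subtype.ext hx⟩
    have hg : g ≫ kerι (cokerπ f) = f := rfl
    exact ⟨{
      Z := coker f
      g := cokerπ f
      w := comp_cokerπ f
      isLimit := KernelFork.IsLimit.ofι _ _ (fun t w => kerLift (cokerπ f) t w ≫ inv g)
        (fun t w => by
          have h2 : inv g ≫ f = kerι (cokerπ f) := by rw [IsIso.inv_comp_eq, hg]
          rw [Category.assoc, h2]
          rfl)
        (fun t w m hm => by rw [← cancel_mono f, hm, Category.assoc,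
          show inv g ≫ f = kerι (cokerπ f) by rw [IsIso.inv_comp_eq, hg]]; rfl) }⟩

instance : IsNormalEpiCategory (GrMod.{v, u} 𝒜) where
  normalEpiOfEpi {M N} f _ := by
    let g : coker (kerι f) ⟶ N := cokerDesc (kerι f) f (kerι_comp f)
    have : IsIso g := isIso_of_bijective g fun j => by
      refine ⟨(injective_iff_map_eq_zero _).2 fun x hx => ?_, fun y => ?_⟩
      · induction x using QuotientAddGroup.induction_on with
        | H x => exact (QuotientAddGroup.eq_zero_iff x).2 ⟨⟨x, hx⟩, rfl⟩
      · obtain ⟨x, hx⟩ := surjective_of_epi f j y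
        exact ⟨QuotientAddGroup.mk x, hx⟩
    have hg : cokerπ (kerι f) ≫ g = f := rfl
    have h2 : f ≫ inv g = cokerπ (kerι f) := by rw [IsIso.comp_inv_eq, hg]
    exact ⟨{
      W := ker f
      g := kerι f
      w := kerι_comp f
      isColimit := CokernelCofork.IsColimit.ofπ _ _
        (fun t w => inv g ≫ cokerDesc (kerι f) t w)
        (fun t w => by rw [← Category.assoc, h2]; rfl)
        (fun t w m hm => by rw [← cancel_epi f, hm, ← Category.assoc, h2]; rfl) }⟩

/-- `Gr A` is an abelian category. -/
instance : Abelian (GrMod.{v, u} 𝒜) where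

end Abelian

/-- The shifted module `M(ℓ)`, with `M(ℓ)_m = M_{m+ℓ}`. -/
def twist (M : GrMod.{v, u} 𝒜) (ℓ : ℤ) : GrMod.{v, u} 𝒜 where
  comp m := M.comp (m + ℓ)
  act i j l h := M.act i (j + ℓ) (l + ℓ) (by omega)
  one_act j x := M.one_act (j + ℓ) x
  mul_act i i' j l l' h h' a b x :=
    M.mul_act i i' (j + ℓ) (l + ℓ) (l' + ℓ) (by omega) (by omega) a b x

/-- `M` is finitely generated: there are finitely many homogeneous elements `x_t ∈ M_{d_t}` such
that every homogeneous element of `M` is a sum of elements of the form `a x_t`, `a ∈ A`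
homogeneous. -/
def IsFG (M : GrMod.{v, u} 𝒜) : Prop :=
  ∃ (n : ℕ) (d : Fin n → ℤ) (x : ∀ t, M.comp (d t)), ∀ (j : ℤ) (y : M.comp j),
    y ∈ AddSubgroup.closure
      {z : M.comp j | ∃ (t : Fin n) (i : ℕ) (h : (i : ℤ) + d t = j) (a : 𝒜 i),
        z = M.act i (d t) j h a (x t)}

variable (𝒜)

/-- The grading of `A` extended by `0` to negative degrees. -/
def intGrading : ℤ → AddSubgroup A
  | Int.ofNat n => (𝒜 n).toAddSubgroup
  | Int.negSucc _ => ⊥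

theorem mul_mem_intGrading (i : ℕ) (j l : ℤ) (h : (i : ℤ) + j = l) {a x : A} (ha : a ∈ 𝒜 i)
    (hx : x ∈ intGrading 𝒜 j) : a * x ∈ intGrading 𝒜 l := by
  match j, hx with
  | Int.ofNat n, hx =>
    obtain rfl : l = Int.ofNat (i + n) := by rw [← h]; rfl
    exact SetLike.GradedMul.mul_mem ha hx
  | Int.negSucc n, hx =>
    obtain rfl : x = 0 := hx
    rw [mul_zero]
    exact zero_mem _

/-- The quotient `A / I` of `A` by a left ideal `I`; its component of degree `j` is the image
of `A_j` in `A / I`. For homogeneous `I` this is the graded module `A / I`. -/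
def quotient (I : Ideal A) : GrMod.{v, u} 𝒜 where
  comp j := (intGrading 𝒜 j).map (Submodule.mkQ I).toAddMonoidHom
  act i j l h :=
    { toFun := fun a =>
        ((DistribSMul.toAddMonoidHom (A ⧸ I) (a : A)).comp (AddSubgroup.subtype _)).codRestrict
          ((intGrading 𝒜 l).map (Submodule.mkQ I).toAddMonoidHom) (by
            rintro ⟨_, x, hx, rfl⟩
            exact ⟨(a : A) * x, mul_mem_intGrading 𝒜 i j l h a.2 hx, rfl⟩)
      map_zero' := by
        ext x
        exact zero_smul A (x : A ⧸ I)
      map_add' := fun a b => by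
        ext x
        exact add_smul (a : A) (b : A) (x : A ⧸ I) }
  one_act j x := Subtype.ext (one_smul A (x : A ⧸ I))
  mul_act i i' j l l' h h' a b x := Subtype.ext (mul_smul (a : A) (b : A) (x : A ⧸ I))

/-- The graded Jacobson radical `J` of `A`: the intersection of all maximal homogeneous left
ideals. -/
def gradedJacobson : Ideal A :=
  sInf {I : Ideal A | Maximal (fun I' : Ideal A => I'.IsHomogeneous 𝒜 ∧ I' ≠ ⊤) I}

/-- The graded module `S = A / J`. -/
def semisimpleQuotient : GrMod.{v, u} 𝒜 := quotient 𝒜 (gradedJacobson 𝒜)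

variable {𝒜}

section Derived

variable [HasDerivedCategory.{w} (GrMod.{v, u} 𝒜)]

/-- The component `H^i(X)_j` of degree `j` of the `i`-th cohomology of `X ∈ D(Gr A)`. -/
abbrev cohomology (X : DerivedCategory (GrMod.{v, u} 𝒜)) (i j : ℤ) : Type u :=
  ((DerivedCategory.homologyFunctor (GrMod.{v, u} 𝒜) i).obj X).comp j

/-- `X ∈ D⁻(gr A)`: the cohomology of `X` is bounded above and finitely generated. -/
def IsDMinusFG (X : DerivedCategory (GrMod.{v, u} 𝒜)) : Prop :=
  (∃ n : ℤ, ∀ i > n, IsZero ((DerivedCategory.homologyFunctor (GrMod.{v, u} 𝒜) i).obj X)) ∧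
    ∀ i : ℤ, ((DerivedCategory.homologyFunctor (GrMod.{v, u} 𝒜) i).obj X).IsFG

/-- The component of degree `j` of `Ext^i_A(X, N) = H^i(RHom_A(X, N))`, the cohomology of the
derived graded Hom, i.e. `Ext^i_{Gr A}(X, N(j)) = Hom_{D(Gr A)}(X, N(j)[i])`. -/
abbrev gExt (X : DerivedCategory (GrMod.{v, u} 𝒜)) (N : GrMod.{v, u} 𝒜) (i j : ℤ) : Type w :=
  X ⟶ (shiftFunctor (DerivedCategory (GrMod.{v, u} 𝒜)) i).obj
    ((DerivedCategory.singleFunctor (GrMod.{v, u} 𝒜) 0).obj (N.twist j))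

end Derived

end GrMod

/-- The supremum degree `sup {i + j | H^i_j ≠ 0}` in `ℤ ∪ {±∞}` of a complex with cohomology
`H^i = ⨁_j H^i_j`. -/
def supDegree (H : ℤ → ℤ → Type*) : EReal :=
  sSup {r : EReal | ∃ i j : ℤ, Nontrivial (H i j) ∧ r = (((i + j : ℤ) : ℝ) : EReal)}

/-- The infimum degree `inf {i + j | H^i_j ≠ 0}` in `ℤ ∪ {±∞}` of a complex with cohomology
`H^i = ⨁_j H^i_j`. -/
def infDegree (H : ℤ → ℤ → Type*) : EReal :=
  sInf {r : EReal | ∃ i j : ℤ, Nontrivial (H i j) ∧ r = (((i + j : ℤ) : ℝ) : EReal)}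

namespace GrMod

variable {k : Type v} [Field k] {A : Type u} [Ring A] [Algebra k A]
  {𝒜 : ℕ → Submodule k A} [GradedAlgebra 𝒜] [HasDerivedCategory.{w} (GrMod.{v, u} 𝒜)]

/-- The infimum degree `ideg X` of `X ∈ D(Gr A)`. -/
def ideg (X : DerivedCategory (GrMod.{v, u} 𝒜)) : EReal :=
  infDegree (cohomology X)

/-- The ext-regularity `extreg X = sdeg RHom_A(X, S)`. -/
def extreg (X : DerivedCategory (GrMod.{v, u} 𝒜)) : EReal :=
  supDegree (gExt X (semisimpleQuotient 𝒜))

end GrMod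

end

open CategoryTheory Limits

noncomputable section

/-! ### Maps from a complex to a single object placed in one degree -/

namespace DerivedCategory

section

universe w' v' u'

variable {C : Type u'} [Category.{v'} C] [Abelian C]

/-! Write `N[-n]` for `N` placed in degree `n`. For injective `I`, all maps `X ⟶ I[-n]` vanish
exactly when all maps `H^n(X) ⟶ I` do. So `H^i(X)_j` is detected by maps to `D[-i]`, where `D` is a
graded `k`-dual of `A`: an injective module, zero above degree `j`, with components of finite length
over the artinian ring `A_0`.

For the inequality, suppose `Ext^{-i}(X, S)_q = 0` for all `q ≥ -j`. Since `A` is `ℕ`-graded, the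
top component of a bounded above module is a submodule, and `S` is just `A_0 / J_0` in degree `0`.
Peeling top components off `D`, each a finite extension of summands of twists of `S`, leaves a
quotient living below all degrees of `H^l(X)`, `l ≥ i` (`homSingleVanishes_of_isFiniteLength`). It
receives no maps from `X` either: embed it in a coinduced injective with the same degree bound, pass
to the cokernel, and repeat until the complex degree exceeds the top cohomology of `X`
(`homSingleVanishes_of_coker`). Hence `H^i(X)_j = 0`.

If `A_0` is semisimple, coinduction from `A_0` itself yields injectives, and the embedding is onto
in the top degree. The bound then drops by one each time the complex degree rises by one, so total
degree stays below `ideg X`. Applied to twists of `S`, this is the reverse inequality. -/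

theorem exists_d_comp_eq_of_injective (K : CochainComplex C ℤ) {I : C} [Injective I] (n : ℤ)
    (h : ∀ g : K.homology n ⟶ I, g = 0) (x : K.X n ⟶ I) (hx : K.d (n - 1) n ≫ x = 0) :
    ∃ y : K.X (n + 1) ⟶ I, K.d n (n + 1) ≫ y = x := by
  -- `x` descends to the opcycles and kills `H^n`, so it factors through the image in `K^{n+1}` and
  -- extends by injectivity.
  have hex : (ShortComplex.mk _ _ (K.homologyι_comp_fromOpcycles n (n + 1))).Exact :=
    ShortComplex.exact_of_f_is_kernel _ (K.homologyIsKernel n (n + 1) (by simp))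
  let x' := K.descOpcycles x (n - 1) (by simp) hx
  refine ⟨hex.descToInjective x' (h _), ?_⟩
  have := hex.comp_descToInjective x' (h _)
  rw [← K.p_fromOpcycles n (n + 1), Category.assoc, this]
  exact K.p_descOpcycles _ _ _ _

/-- The extension of `φ.f n` along the differential is the only nonzero component of a contracting
homotopy. -/
theorem homotopy_zero_of_injective (K : CochainComplex C ℤ) {I : C} [Injective I] (n : ℤ)
    (h : ∀ g : K.homology n ⟶ I, g = 0)
    (φ : K ⟶ (HomologicalComplex.single C (ComplexShape.up ℤ) n).obj I) :
    Nonempty (Homotopy φ 0) := by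
  obtain ⟨y, hy⟩ := exists_d_comp_eq_of_injective K n h
    (φ.f n ≫ (HomologicalComplex.singleObjXSelf (ComplexShape.up ℤ) n I).hom) (by
      rw [← φ.comm_assoc]; simp)
  let s : ∀ i j, (ComplexShape.up ℤ).Rel j i →
      (K.X i ⟶ ((HomologicalComplex.single C (ComplexShape.up ℤ) n).obj I).X j) := fun i j hij =>
    if hj : j = n then (K.XIsoOfEq (by rw [← hj]; exact hij.symm)).hom ≫ y ≫
      (HomologicalComplex.singleObjXIsoOfEq (ComplexShape.up ℤ) n I j hj).inv else 0
  have hφ : φ = Homotopy.nullHomotopicMap' s := by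
    apply HomologicalComplex.to_single_hom_ext
    rw [Homotopy.nullHomotopicMap'_f (k₂ := n - 1) (k₁ := n) (k₀ := n + 1) (by simp) (by simp)]
    have hs : s (n + 1) n (by simp) =
        y ≫ (HomologicalComplex.singleObjXSelf (ComplexShape.up ℤ) n I).inv := by
      simp [s, HomologicalComplex.singleObjXSelf]
    rw [hs, HomologicalComplex.single_obj_d, comp_zero, add_zero, reassoc_of% hy]
    simp
  rw [hφ]
  exact ⟨Homotopy.nullHomotopy' s⟩

variable [HasDerivedCategory.{w'} C]

/-- Every morphism from `X` to the complex `N` placed in degree `n` is zero. -/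
def HomSingleVanishes (X : DerivedCategory C) (N : C) (n : ℤ) : Prop :=
  ∀ f : X ⟶ (singleFunctor C n).obj N, f = 0

theorem homSingleVanishes_iff_of_iso {X Y : DerivedCategory C} (e : X ≅ Y) (N : C) (n : ℤ) :
    HomSingleVanishes X N n ↔ HomSingleVanishes Y N n := by
  refine ⟨fun h f => ?_, fun h f => ?_⟩
  · rw [← cancel_epi e.hom, h (e.hom ≫ f), comp_zero]
  · rw [← cancel_epi e.inv, h (e.inv ≫ f), comp_zero]

theorem HomSingleVanishes.of_retract {X : DerivedCategory C} {N N' : C} {n : ℤ}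
    (h : HomSingleVanishes X N n) (i : N' ⟶ N) (r : N ⟶ N') (hir : i ≫ r = 𝟙 N') :
    HomSingleVanishes X N' n := by
  intro f
  have h1 : f = (f ≫ (singleFunctor C n).map i) ≫ (singleFunctor C n).map r := by
    rw [Category.assoc, ← Functor.map_comp, hir, CategoryTheory.Functor.map_id, Category.comp_id]
  rw [h1, h (f ≫ _), zero_comp]

theorem homSingleVanishes_of_isZero (X : DerivedCategory C) {N : C} (hN : IsZero N) (n : ℤ) :
    HomSingleVanishes X N n := fun _ =>
  ((singleFunctor C n).map_isZero hN).eq_of_tgt _ _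

theorem homSingleVanishes_of_isLE (X : DerivedCategory C) (N : C) {m n : ℤ}
    (hX : ∀ i > m, IsZero ((homologyFunctor C i).obj X)) (hmn : m < n) :
    HomSingleVanishes X N n := by
  have : X.IsLE m := (isLE_iff X m).2 hX
  intro f
  exact TStructure.t.zero f m n hmn

/-- Fixes the sign convention: placing `N` in degree `-p` is shifting it by `p`, so the vanishing
concerns `Ext^p`. -/
theorem homSingleVanishes_neg_iff (X : DerivedCategory C) (N : C) (p : ℤ) :
    HomSingleVanishes X N (-p) ↔
      Subsingleton (X ⟶ (shiftFunctor (DerivedCategory C) p).obj ((singleFunctor C 0).obj N)) := by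
  let e := ((singleFunctors C).shiftIso p (-p) 0 (by lia)).app N
  refine ⟨fun h => ⟨fun f g => ?_⟩, fun h f => ?_⟩
  · rw [← cancel_mono e.hom]
    exact (h _).trans (h _).symm
  · rw [← cancel_mono e.inv]
    exact h.elim _ _

section ShortExact

variable {S : ShortComplex C} (hS : S.ShortExact)

include hS

theorem HomSingleVanishes.middle {X : DerivedCategory C} {n : ℤ}
    (h₁ : HomSingleVanishes X S.X₁ n) (h₃ : HomSingleVanishes X S.X₃ n) :
    HomSingleVanishes X S.X₂ n := by
  intro f
  have hS' := hS.map_of_exact (HomologicalComplex.single C (ComplexShape.up ℤ) n)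
  obtain ⟨g, hg⟩ := Pretriangulated.Triangle.coyoneda_exact₂ _
    (triangleOfSES_distinguished hS') f (h₃ _)
  exact hg.trans (by rw [show g = 0 from h₁ g]; exact zero_comp)

/-- Long exact sequence, at the connecting map. The statement is first moved to the triangle in
degree `n + 1`, whose third morphism ends in the shift of `S.X₁`. -/
theorem HomSingleVanishes.left {X : DerivedCategory C} {n : ℤ}
    (h₂ : HomSingleVanishes X S.X₂ n) (h₃ : HomSingleVanishes X S.X₃ (n + 1)) :
    HomSingleVanishes X S.X₁ n := by
  have key : ∀ N, HomSingleVanishes X N n ↔ ∀ f : X ⟶ (shiftFunctor (DerivedCategory C) (1 : ℤ)).obj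
      ((singleFunctor C (n + 1)).obj N), f = 0 := fun N => by
    let e := ((singleFunctors C).shiftIso 1 n (n + 1) (by lia)).app N
    refine ⟨fun h f => ?_, fun h f => ?_⟩
    · rw [← cancel_mono e.hom]
      exact (h _).trans zero_comp.symm
    · rw [← cancel_mono e.inv]
      exact (h _).trans zero_comp.symm
  rw [key] at h₂ ⊢
  intro f
  have hS' := hS.map_of_exact (HomologicalComplex.single C (ComplexShape.up ℤ) (n + 1))
  obtain ⟨g, hg⟩ := Pretriangulated.Triangle.coyoneda_exact₁ _
    (triangleOfSES_distinguished hS') f (h₂ _)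
  exact hg.trans (by rw [show g = 0 from h₃ g]; exact zero_comp)

end ShortExact

/-- A single injective is a bounded below complex of injectives, hence K-injective, so derived maps
into it come from chain maps, which are null-homotopic here. -/
theorem homSingleVanishes_of_injective (X : DerivedCategory C) (I : C) [Injective I] (n : ℤ)
    (h : ∀ g : (homologyFunctor C n).obj X ⟶ I, g = 0) : HomSingleVanishes X I n := by
  let K := Q.objPreimage X
  let e : Q.obj K ≅ X := Q.objObjPreimageIso X
  rw [← homSingleVanishes_iff_of_iso e]
  have hK : ∀ g : K.homology n ⟶ I, g = 0 := fun g => by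
    let e' : (homologyFunctor C n).obj X ≅ K.homology n := (homologyFunctor C n).mapIso e.symm ≪≫ (homologyFunctorFactors C n).app K
    rw [← cancel_epi e'.hom]
    exact (h _).trans comp_zero.symm
  intro f
  let L : CochainComplex C ℤ := (HomologicalComplex.single C (ComplexShape.up ℤ) n).obj I
  have : ∀ m, Injective (L.X m) := fun m => by
    by_cases hm : m = n
    · exact Injective.of_iso (HomologicalComplex.singleObjXIsoOfEq _ n I m hm).symm inferInstance
    · exact Injective.of_iso (HomologicalComplex.isZero_single_obj_X _ n I m hm).isoZero.symm
        inferInstance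
  have hL : L.IsKInjective := CochainComplex.isKInjective_of_injective L n
  obtain ⟨g, hg⟩ := (CochainComplex.IsKInjective.Qh_map_bijective ((HomotopyCategory.quotient _ _).obj K) L).surjective f
  obtain ⟨φ, rfl⟩ := (HomotopyCategory.quotient _ _).map_surjective g
  rw [← hg, HomotopyCategory.eq_of_homotopy _ _ (homotopy_zero_of_injective K n hK φ).some,
    Functor.map_zero, Functor.map_zero]
  rfl

/-- Injectivity extends `g` from `H^n` to the opcycles, giving a chain map to `I` in degree `n`. It
is zero in the derived category, hence on `H^n`, where it recovers `g`. -/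
theorem HomSingleVanishes.homology_eq_zero {X : DerivedCategory C} {I : C} [Injective I] {n : ℤ}
    (h : HomSingleVanishes X I n) (g : (homologyFunctor C n).obj X ⟶ I) : g = 0 := by
  let K := Q.objPreimage X
  let e : Q.obj K ≅ X := Q.objObjPreimageIso X
  rw [← homSingleVanishes_iff_of_iso e] at h
  let e' : (homologyFunctor C n).obj X ≅ K.homology n := (homologyFunctor C n).mapIso e.symm ≪≫ (homologyFunctorFactors C n).app K
  suffices hK : ∀ g : K.homology n ⟶ I, g = 0 by
    rw [← cancel_epi e'.inv, comp_zero]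
    exact hK _
  intro g
  let y := Injective.factorThru g (K.homologyι n)
  have hy : K.homologyι n ≫ y = g := Injective.comp_factorThru _ _
  let φ : K ⟶ (HomologicalComplex.single C (ComplexShape.up ℤ) n).obj I :=
    HomologicalComplex.mkHomToSingle (K.pOpcycles n ≫ y) (fun i _ => by simp)
  have hφ : HomologicalComplex.homologyMap φ n = 0 := by
    have h1 : Q.map φ = 0 := h _
    have h2 := homologyFunctorFactors_hom_naturality φ n
    rw [h1, Functor.map_zero, zero_comp] at h2
    exact (cancel_epi ((homologyFunctorFactors C n).hom.app K)).1 (h2.symm.trans comp_zero.symm)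
  have h3 := HomologicalComplex.homologyι_naturality φ n
  let t := ((HomologicalComplex.single C (ComplexShape.up ℤ) n).obj I).descOpcycles
    (HomologicalComplex.singleObjXSelf (ComplexShape.up ℤ) n I).hom (n - 1) (by simp) (by simp)
  have h4 : HomologicalComplex.opcyclesMap φ n ≫ t = y := by
    rw [← cancel_epi (K.pOpcycles n)]
    simp [t, φ]
  rw [← hy, ← h4, ← Category.assoc, ← h3, hφ, zero_comp, zero_comp]

end

end DerivedCategory

/-! ### Componentwise exactness and the action of `A_0` -/

namespace GrMod

variable {k : Type v} [Field k] {A : Type u} [Ring A] [Algebra k A]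
  {𝒜 : ℕ → Submodule k A} [GradedAlgebra 𝒜]

theorem mono_of_injective {M N : GrMod.{v, u} 𝒜} (f : M ⟶ N)
    (hf : ∀ j, Function.Injective (f.app j)) : Mono f :=
  ⟨fun _ _ w => hom_ext fun j x => hf j (congrArg (fun t => Hom.app t j x) w)⟩

theorem epi_of_surjective {M N : GrMod.{v, u} 𝒜} (f : M ⟶ N)
    (hf : ∀ j, Function.Surjective (f.app j)) : Epi f :=
  ⟨fun g h w => hom_ext fun j y => by
    obtain ⟨x, rfl⟩ := hf j y
    exact congrArg (fun t => Hom.app t j x) w⟩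

theorem isZero_of_subsingleton {M : GrMod.{v, u} 𝒜} (h : ∀ j, Subsingleton (M.comp j)) :
    IsZero M := by
  rw [IsZero.iff_id_eq_zero]
  exact hom_ext fun j _ => (h j).elim _ _

/-- A sequence of graded modules is short exact if all its homogeneous components are. -/
theorem shortExact_of_components (S : ShortComplex (GrMod.{v, u} 𝒜))
    (hf : ∀ j, Function.Injective (S.f.app j)) (hg : ∀ j, Function.Surjective (S.g.app j))
    (hfg : ∀ j (x : S.X₂.comp j), S.g.app j x = 0 → ∃ y, S.f.app j y = x) : S.ShortExact := by
  let t : S.X₁ ⟶ ker S.g := kerLift S.g S.f S.zero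
  have ht : IsIso t := isIso_of_bijective t fun j =>
    ⟨fun x y hxy => hf j (congrArg Subtype.val hxy), fun x => by
      obtain ⟨y, hy⟩ := hfg j x.1 x.2
      exact ⟨y, Subtype.ext hy⟩⟩
  have h1 : inv t ≫ S.f = kerι S.g := by
    rw [IsIso.inv_comp_eq]
    rfl
  have hmono := mono_of_injective S.f hf
  exact {
    exact := ShortComplex.exact_of_f_is_kernel _ (KernelFork.IsLimit.ofι _ _
      (fun g w => kerLift S.g g w ≫ inv t)
      (fun g w => by rw [Category.assoc, h1]; rfl)
      (fun g w m hm => by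
        rw [← cancel_mono S.f, hm, Category.assoc, h1]
        rfl))
    mono_f := hmono
    epi_g := epi_of_surjective S.g hg }

/-- A homomorphism which is injective on components is part of a short exact sequence. -/
theorem shortExact_cokerπ {M N : GrMod.{v, u} 𝒜} (f : M ⟶ N)
    (hf : ∀ j, Function.Injective (f.app j)) :
    (ShortComplex.mk f (cokerπ f) (comp_cokerπ f)).ShortExact :=
  shortExact_of_components _ hf (fun _ => QuotientAddGroup.mk'_surjective _)
    (fun _ x hx => (QuotientAddGroup.eq_zero_iff x).1 hx)

theorem act_eq_of_eq (M : GrMod.{v, u} 𝒜) {i i' : ℕ} {j l : ℤ} (h : (i : ℤ) + j = l)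
    (h' : (i' : ℤ) + j = l) {a : 𝒜 i} {a' : 𝒜 i'} (ha : (a : A) = a') (x : M.comp j) :
    M.act i j l h a x = M.act i' j l h' a' x := by
  obtain rfl : i = i' := by omega
  obtain rfl : a = a' := Subtype.ext ha
  rfl

/-- The components of a graded `A`-module are modules over `A_0`. -/
instance compModule (M : GrMod.{v, u} 𝒜) (j : ℤ) : Module (𝒜 0) (M.comp j) where
  smul a x := M.act 0 j j (by simp) a x
  one_smul x := M.one_act j x
  mul_smul a b x := (act_eq_of_eq M _ _ rfl x).trans
    (M.mul_act 0 0 j j j (by simp) (by simp) a b x)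
  smul_zero a := map_zero _
  smul_add a := map_add _
  add_smul a b x := by
    change M.act 0 j j _ (a + b) x = _
    rw [map_add]
    rfl
  zero_smul x := by
    change M.act 0 j j _ 0 x = _
    rw [map_zero]
    rfl

theorem smul_def (M : GrMod.{v, u} 𝒜) {j : ℤ} (a : 𝒜 0) (x : M.comp j) :
    a • x = M.act 0 j j (by simp) a x := rfl

theorem smul_act (M : GrMod.{v, u} 𝒜) {i : ℕ} {j l : ℤ} (h : (i : ℤ) + j = l) (a : 𝒜 i)
    (b : 𝒜 0) (c : 𝒜 i) (hc : (c : A) = b * a) (x : M.comp j) :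
    b • M.act i j l h a x = M.act i j l h c x :=
  (M.mul_act 0 i j l l h (by simp) b a x).symm.trans (act_eq_of_eq M _ _ hc.symm x)

theorem act_act (M : GrMod.{v, u} 𝒜) {i i' i'' : ℕ} {j l l' : ℤ} (h : (i' : ℤ) + j = l)
    (h' : (i : ℤ) + l = l') (h'' : (i'' : ℤ) + j = l') (a : 𝒜 i) (b : 𝒜 i') (c : 𝒜 i'')
    (hc : (c : A) = a * b) (x : M.comp j) :
    M.act i l l' h' a (M.act i' j l h b x) = M.act i'' j l' h'' c x :=
  (M.mul_act i i' j l l' h h' a b x).symm.trans (act_eq_of_eq M _ _ hc.symm x)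

theorem hom_map_smul {M N : GrMod.{v, u} 𝒜} (f : M ⟶ N) (j : ℤ) (a : 𝒜 0) (x : M.comp j) :
    f.app j (a • x) = a • f.app j x :=
  hom_map_act f 0 j j (by simp) a x

/-! ### Coinduced modules and dimension shifting -/

section Coinduced

variable {R : Type*} [Ring R] (φ : R →+* 𝒜 0)

/-- The components of a graded module as modules over a ring mapping to `A_0`. -/
abbrev compRestrict (M : GrMod.{v, u} 𝒜) (j : ℤ) : Module R (M.comp j) :=
  Module.compHom _ φ

variable (V : ℤ → Type u) [∀ j, AddCommGroup (V j)] [∀ j, Module R (V j)]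

/-- The component of degree `m` of the coinduced module: families of `R`-linear maps
`A_i → V_l` with `i + m = l`. -/
def coindComp (m : ℤ) :
    AddSubgroup (∀ t : {t : ℕ × ℤ // (t.1 : ℤ) + m = t.2}, 𝒜 t.1.1 →+ V t.1.2) where
  carrier := {f | ∀ t (r : R) (b b' : 𝒜 t.1.1), (b' : A) = (φ r : A) * b → f t b' = r • f t b}
  zero_mem' t r b b' _ := by simp
  add_mem' hf hg t r b b' h := by simp [hf t r b b' h, hg t r b b' h]
  neg_mem' hf t r b b' h := by simp [hf t r b b' h]

variable {φ V} in
theorem coindComp_eq_of_eq {m : ℤ} (f : coindComp φ V m) {i i' : ℕ} {l : ℤ} (h : (i : ℤ) + m = l)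
    (h' : (i' : ℤ) + m = l) {b : 𝒜 i} {b' : 𝒜 i'} (hb : (b : A) = b') :
    f.1 ⟨(i, l), h⟩ b = f.1 ⟨(i', l), h'⟩ b' := by
  obtain rfl : i = i' := by omega
  obtain rfl : b = b' := Subtype.ext hb
  rfl

/-- Right multiplication `A_i → A_{i + i'}` by an element of `A_{i'}`. -/
def mulRight {i' : ℕ} (a : 𝒜 i') (i : ℕ) : 𝒜 i →+ 𝒜 (i + i') where
  toFun b := ⟨(b : A) * a, SetLike.GradedMul.mul_mem b.2 a.2⟩
  map_zero' := Subtype.ext (zero_mul _)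
  map_add' _ _ := Subtype.ext (add_mul _ _ _)

theorem mulRight_zero {i' : ℕ} (i : ℕ) (b : 𝒜 i) : mulRight (0 : 𝒜 i') i b = 0 :=
  Subtype.ext (mul_zero (b : A))

theorem mulRight_add {i' : ℕ} (a a' : 𝒜 i') (i : ℕ) (b : 𝒜 i) :
    mulRight (a + a') i b = mulRight a i b + mulRight a' i b :=
  Subtype.ext (mul_add (b : A) a a')

/-- The graded module coinduced from a graded `R`-module `V`, along a ring homomorphism
`R → A_0`. -/
def coind : GrMod.{v, u} 𝒜 where
  comp m := coindComp φ V m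
  act i j l h :=
    { toFun := fun a =>
        { toFun := fun f => ⟨fun t =>
            (f.1 ⟨(t.1.1 + i, t.1.2), by have := t.2; push_cast; omega⟩).comp (mulRight a t.1.1),
            fun t r b b' hb => f.2 _ r _ _ (by
              change (b' : A) * a = φ r * (b * a)
              rw [hb, mul_assoc])⟩
          map_zero' := rfl
          map_add' := fun _ _ => rfl }
      map_zero' := by
        refine AddMonoidHom.ext fun f =>
          Subtype.ext (funext fun t => AddMonoidHom.ext fun b => ?_)
        exact (congrArg (f.1 _) (mulRight_zero _ b)).trans (map_zero (f.1 _))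
      map_add' := fun a a' => by
        refine AddMonoidHom.ext fun f =>
          Subtype.ext (funext fun t => AddMonoidHom.ext fun b => ?_)
        exact (congrArg (f.1 _) (mulRight_add a a' _ b)).trans (map_add (f.1 _) _ _) }
  one_act j f := Subtype.ext (funext fun t => AddMonoidHom.ext fun b =>
    coindComp_eq_of_eq f _ _ (mul_one (b : A)))
  mul_act i i' j l l' h h' a b f := Subtype.ext (funext fun t => AddMonoidHom.ext fun c =>
    coindComp_eq_of_eq f _ _ (mul_assoc (c : A) a b).symm)

variable {V}

/-- Evaluation at `1`. -/
def coindEval (j : ℤ) : (coind φ V).comp j →+ V j where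
  toFun f := f.1 ⟨(0, j), by simp⟩ 1
  map_zero' := rfl
  map_add' _ _ := rfl

theorem coindEval_act {i : ℕ} {j l : ℤ} (h : (i : ℤ) + j = l) (a : 𝒜 i)
    (f : (coind φ V).comp j) : coindEval φ l ((coind φ V).act i j l h a f) = f.1 ⟨(i, l), h⟩ a :=
  coindComp_eq_of_eq f _ _ (one_mul (a : A))

theorem coindEval_smul {j : ℤ} (r : R) (f : (coind φ V).comp j) :
    coindEval φ j (φ r • f) = r • coindEval φ j f :=
  (coindEval_act φ _ _ _).trans (f.2 ⟨(0, j), by simp⟩ r 1 (φ r) (mul_one _).symm)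

/-- The homomorphism to a coinduced module determined by `R`-linear maps on components. -/
def toCoind {M : GrMod.{v, u} 𝒜} (g : ∀ j, M.comp j →+ V j)
    (hg : ∀ j (r : R) (x : M.comp j), g j (φ r • x) = r • g j x) : M ⟶ coind φ V where
  app j :=
    { toFun := fun x => ⟨fun t => (g t.1.2).comp ((M.act t.1.1 j t.1.2 t.2).flip x),
        fun t r b b' hb => by
          change g _ (M.act _ _ _ _ b' x) = r • g _ (M.act _ _ _ _ b x)
          rw [← hg, smul_act M t.2 b (φ r) b' hb x]⟩
      map_zero' := Subtype.ext (funext fun t => AddMonoidHom.ext fun b => by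
        change g _ (M.act _ _ _ _ b 0) = 0
        simp)
      map_add' := fun x y => Subtype.ext (funext fun t => AddMonoidHom.ext fun b => by
        change g _ (M.act _ _ _ _ b (x + y)) = g _ (M.act _ _ _ _ b x) + g _ (M.act _ _ _ _ b y)
        simp) }
  map_act i j l h a x := Subtype.ext (funext fun t => AddMonoidHom.ext fun b => by
    change g _ (M.act _ _ _ _ b (M.act _ _ _ _ a x)) = g _ (M.act _ _ _ _ (mulRight a t.1.1 b) x)
    rw [act_act M h t.2 (by have := t.2; push_cast; omega) b a (mulRight a t.1.1 b) rfl x])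

theorem coindEval_toCoind {M : GrMod.{v, u} 𝒜} (g : ∀ j, M.comp j →+ V j)
    (hg : ∀ j (r : R) (x : M.comp j), g j (φ r • x) = r • g j x) (j : ℤ) (x : M.comp j) :
    coindEval φ j ((toCoind φ g hg).app j x) = g j x :=
  congrArg (g j) (M.one_act j x)

/-- The value of a family at `a` is the evaluation at `1` of its multiple by `a`. -/
theorem toCoind_ext {M : GrMod.{v, u} 𝒜} {f g : M ⟶ coind φ V}
    (h : ∀ j x, coindEval φ j (f.app j x) = coindEval φ j (g.app j x)) : f = g :=
  hom_ext fun j x => Subtype.ext (funext fun t => AddMonoidHom.ext fun b => by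
    obtain ⟨⟨i, l⟩, ht⟩ := t
    have h1 := h l (M.act i j l ht b x)
    rwa [hom_map_act, hom_map_act, coindEval_act, coindEval_act] at h1)

/-- Coinduction is right adjoint to restriction to graded `R`-modules, where every monomorphism
splits. -/
instance injective_coind [IsSemisimpleRing R] : Injective (coind φ V) where
  factors {M N} g f _ := by
    let := compRestrict φ M
    let := compRestrict φ N
    let fR : ∀ j, M.comp j →ₗ[R] N.comp j := fun j =>
      { toFun := f.app j
        map_add' := map_add _
        map_smul' := fun r x => hom_map_smul f j (φ r) x }
    let gR : ∀ j, M.comp j →ₗ[R] V j := fun j =>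
      { toFun := fun x => coindEval φ j (g.app j x)
        map_add' := by simp
        map_smul' := fun r x => by
          change coindEval φ j (g.app j (φ r • x)) = _
          rw [hom_map_smul, coindEval_smul]
          rfl }
    choose h hh using fun j =>
      IsSemisimpleModule.extension_property (fR j) (injective_of_mono f j) (gR j)
    have hlin : ∀ j (r : R) (x : N.comp j),
        (h j).toAddMonoidHom (φ r • x) = r • (h j).toAddMonoidHom x :=
      fun j r x => map_smul (h j) r x
    refine ⟨toCoind φ (fun j => (h j).toAddMonoidHom) hlin, ?_⟩
    refine toCoind_ext φ fun j x => ?_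
    exact (coindEval_toCoind φ (fun j => (h j).toAddMonoidHom) hlin j (f.app j x)).trans
      (LinearMap.congr_fun (hh j) x)

theorem toCoind_eq_zero {M : GrMod.{v, u} 𝒜} (h : ∀ j, Subsingleton (M.comp j) ∨ Subsingleton (V j))
    (f : M ⟶ coind φ V) : f = 0 :=
  toCoind_ext φ fun j x => by
    rcases h j with h | h
    · rw [Subsingleton.elim x 0, map_zero (f.app j), map_zero (Hom.app (0 : M ⟶ _) j)]
    · exact Subsingleton.elim _ _

/-- Degree `m` only involves `V_l` with `l ≥ m`, because `A` has no negative degrees. -/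
theorem subsingleton_coind_comp {c : ℤ} (hV : ∀ j > c, Subsingleton (V j)) {m : ℤ} (hm : c < m) :
    Subsingleton ((coind φ V).comp m) :=
  ⟨fun f g => Subtype.ext (funext fun t => AddMonoidHom.ext fun b =>
    (hV _ (by have := t.2; omega)).elim _ _)⟩

/-- The embedding of a graded module into the module coinduced from its restriction. -/
def coindUnit (N : GrMod.{v, u} 𝒜) :
    letI := compRestrict φ N
    N ⟶ coind φ N.comp :=
  letI := compRestrict φ N
  toCoind φ (fun _ => AddMonoidHom.id _) (fun _ _ _ => rfl)

theorem coindUnit_injective (N : GrMod.{v, u} 𝒜) (j : ℤ) :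
    Function.Injective ((coindUnit φ N).app j) := by
  let := compRestrict φ N
  refine Function.LeftInverse.injective (g := coindEval φ j) fun x => ?_
  exact coindEval_toCoind φ _ _ j x

/-- If `R → A_0` is surjective, then the embedding of a graded module `N` into its coinduced module
is surjective in the highest degree of `N`. -/
theorem coindUnit_surjective (hφ : Function.Surjective φ) (N : GrMod.{v, u} 𝒜) {c : ℤ}
    (hN : ∀ j > c, Subsingleton (N.comp j)) : Function.Surjective ((coindUnit φ N).app c) := by
  let := compRestrict φ N
  intro f
  refine ⟨coindEval φ c f, Subtype.ext (funext fun t => AddMonoidHom.ext fun b => ?_)⟩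
  obtain ⟨⟨i, l⟩, ht⟩ := t
  by_cases hi : i = 0
  · subst hi
    obtain rfl : c = l := by simpa using ht
    obtain ⟨r, rfl⟩ := hφ b
    exact (f.2 ⟨(0, c), ht⟩ r 1 (φ r) (mul_one _).symm).symm
  · exact (hN l (by simp only at ht; omega)).elim _ _

theorem subsingleton_coker {M N : GrMod.{v, u} 𝒜} (f : M ⟶ N) {j : ℤ}
    (h : Function.Surjective (f.app j)) : Subsingleton ((coker f).comp j) := by
  have h0 : ∀ x : (coker f).comp j, x = 0 := fun x => by
    induction x using QuotientAddGroup.induction_on with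
    | H x => exact (QuotientAddGroup.eq_zero_iff x).2 (h x)
  exact ⟨fun x y => (h0 x).trans (h0 y).symm⟩

theorem subsingleton_coker_coindUnit (N : GrMod.{v, u} 𝒜) {c : ℤ}
    (hN : ∀ j > c, Subsingleton (N.comp j)) {m : ℤ} (hm : c < m) :
    Subsingleton ((coker (coindUnit φ N)).comp m) := by
  let := compRestrict φ N
  have h := subsingleton_coind_comp φ (V := N.comp) hN hm
  exact subsingleton_coker _ fun y => ⟨0, h.elim _ _⟩

variable [IsSemisimpleRing R] [HasDerivedCategory.{w} (GrMod.{v, u} 𝒜)]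

/-- Dimension shifting along coinduced modules. -/
theorem homSingleVanishes_of_coker (X : DerivedCategory (GrMod.{v, u} 𝒜))
    (hX : ∃ m : ℤ, ∀ i > m, IsZero ((DerivedCategory.homologyFunctor (GrMod.{v, u} 𝒜) i).obj X))
    (c : ℤ → ℤ)
    (hc : ∀ (i : ℤ) (N : GrMod.{v, u} 𝒜), (∀ j > c i, Subsingleton (N.comp j)) →
      ∀ j > c (i + 1), Subsingleton ((coker (coindUnit φ N)).comp j))
    (n : ℤ) (hXc : ∀ i ≥ n, ∀ j ≤ c i, Subsingleton (cohomology X i j))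
    (N : GrMod.{v, u} 𝒜) (hN : ∀ j > c n, Subsingleton (N.comp j)) :
    DerivedCategory.HomSingleVanishes X N n := by
  obtain ⟨m, hm⟩ := hX
  -- `d` bounds the number of shifts needed to pass the top cohomology of `X`.
  obtain ⟨d, hd⟩ : ∃ d : ℕ, m < n + d := ⟨(m - n + 1).toNat, by omega⟩
  induction d generalizing n N with
  | zero => exact DerivedCategory.homSingleVanishes_of_isLE X N hm (by simpa using hd)
  | succ d ih =>
    let := compRestrict φ N
    refine DerivedCategory.HomSingleVanishes.left
      (shortExact_cokerπ (coindUnit φ N) (coindUnit_injective φ N)) ?_ ?_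
    · refine DerivedCategory.homSingleVanishes_of_injective X (coind φ N.comp) n fun g =>
        toCoind_eq_zero φ (fun j => ?_) g
      -- In each degree either the source `H^n(X)` or the target `N` vanishes.
      by_cases hj : j ≤ c n
      · exact Or.inl (hXc n le_rfl j hj)
      · exact Or.inr (hN j (by omega))
    · exact ih (n + 1) (fun i hi => hXc i (by omega)) _ (hc n N hN) (by push_cast at hd; omega)

/-- Coinducing from the field `k` gives injectives without any assumption on `A_0`; the degree bound
is merely preserved. -/
theorem homSingleVanishes_of_le (X : DerivedCategory (GrMod.{v, u} 𝒜))
    (hX : ∃ m : ℤ, ∀ i > m, IsZero ((DerivedCategory.homologyFunctor (GrMod.{v, u} 𝒜) i).obj X))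
    (n c : ℤ) (hXc : ∀ i ≥ n, ∀ j ≤ c, Subsingleton (cohomology X i j))
    (N : GrMod.{v, u} 𝒜) (hN : ∀ j > c, Subsingleton (N.comp j)) :
    DerivedCategory.HomSingleVanishes X N n :=
  homSingleVanishes_of_coker (algebraMap k (𝒜 0)) X hX (fun _ => c)
    (fun _ N hN _ hj => subsingleton_coker_coindUnit _ N hN hj) n hXc N hN

theorem homSingleVanishes_of_add_lt (hφ : Function.Surjective φ)
    (X : DerivedCategory (GrMod.{v, u} 𝒜))
    (hX : ∃ m : ℤ, ∀ i > m, IsZero ((DerivedCategory.homologyFunctor (GrMod.{v, u} 𝒜) i).obj X))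
    (n d : ℤ) (hXd : ∀ i j, i + j < d → Subsingleton (cohomology X i j))
    (N : GrMod.{v, u} 𝒜) (hN : ∀ j, d ≤ n + j → Subsingleton (N.comp j)) :
    DerivedCategory.HomSingleVanishes X N n := by
  -- This bound keeps complex degree plus internal degree below `d`; it must drop by one per step,
  -- which surjectivity in the top degree provides.
  refine homSingleVanishes_of_coker φ X hX (fun i => d - 1 - i) (fun i N hN j hj => ?_) n
    (fun i _ j hj => hXd i j (by omega)) N (fun j hj => hN j (by omega))
  by_cases h : d - 1 - i < j
  · exact subsingleton_coker_coindUnit φ N hN h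
  · obtain rfl : j = d - 1 - i := by omega
    exact subsingleton_coker _ (coindUnit_surjective φ hφ N hN)

end Coinduced

end GrMod

namespace GrMod

variable {k : Type v} [Field k] {A : Type u} [Ring A] [Algebra k A]
  {𝒜 : ℕ → Submodule k A} [GradedAlgebra 𝒜]

open GradedRing in
theorem projZero_eq_zero {i : ℕ} (hi : i ≠ 0) (a : 𝒜 i) : projZeroRingHom' 𝒜 (a : A) = 0 :=
  Subtype.ext (DirectSum.decompose_of_mem_ne 𝒜 a.2 hi)

/-! ### Modules concentrated in one degree and top components -/

section Concentrated

open GradedRing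

variable (W : Type u) [AddCommGroup W] [Module (𝒜 0) W]

/-- The component of degree `j` of the graded module given by `W` in degree `m`. -/
def concComp (m j : ℤ) : AddSubgroup W where
  carrier := {w | j ≠ m → w = 0}
  zero_mem' _ := rfl
  add_mem' ha hb h := by simp [ha h, hb h]
  neg_mem' ha h := by simp [ha h]

variable (𝒜) in
/-- The graded module given by the `A_0`-module `W` placed in degree `m`. -/
def conc (m : ℤ) : GrMod.{v, u} 𝒜 where
  comp j := concComp W m j
  -- `A` acts through the projection to `A_0`, so positive degrees act by zero.
  act i j l h :=
    { toFun := fun a =>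
        ((DistribSMul.toAddMonoidHom W (projZeroRingHom' 𝒜 (a : A))).comp
          (AddSubgroup.subtype _)).codRestrict (concComp W m l) (fun w hl => by
            change projZeroRingHom' 𝒜 (a : A) • (w : W) = 0
            by_cases hi : i = 0
            · subst hi
              rw [w.2 (by rintro rfl; exact hl (by simpa using h.symm)), smul_zero]
            · rw [projZero_eq_zero hi, zero_smul])
      map_zero' := AddMonoidHom.ext fun w => Subtype.ext (by
        change projZeroRingHom' 𝒜 ((0 : 𝒜 i) : A) • (w : W) = 0
        simp)
      map_add' := fun a b => AddMonoidHom.ext fun w => Subtype.ext (by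
        change projZeroRingHom' 𝒜 ((a + b : 𝒜 i) : A) • (w : W) =
          projZeroRingHom' 𝒜 (a : A) • (w : W) + projZeroRingHom' 𝒜 (b : A) • (w : W)
        rw [← add_smul, ← map_add]
        rfl) }
  one_act j w := Subtype.ext (by
    change projZeroRingHom' 𝒜 (1 : A) • (w : W) = w
    simp)
  mul_act i i' j l l' h h' a b w := Subtype.ext (by
    change projZeroRingHom' 𝒜 ((a : A) * b) • (w : W) =
      projZeroRingHom' 𝒜 (a : A) • projZeroRingHom' 𝒜 (b : A) • (w : W)
    rw [map_mul, mul_smul])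

variable {W} {W' : Type u} [AddCommGroup W'] [Module (𝒜 0) W']

/-- Functoriality of `conc`. -/
def concMap (f : W →ₗ[𝒜 0] W') (m : ℤ) : conc 𝒜 W m ⟶ conc 𝒜 W' m where
  app j := (f.toAddMonoidHom.comp (AddSubgroup.subtype _)).codRestrict (concComp W' m j)
    (fun w hj => (congrArg f (w.2 hj)).trans (map_zero f))
  map_act _ _ _ _ a w := Subtype.ext (map_smul f (projZeroRingHom' 𝒜 (a : A)) w.1)

theorem concMap_subtype_mkQ (N : Submodule (𝒜 0) W) (m : ℤ) :
    concMap (W := N) N.subtype m ≫ concMap (W' := W ⧸ N) N.mkQ m = 0 := by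
  refine hom_ext fun j w => Subtype.ext ?_
  have h : N.mkQ (w.1 : N) = 0 := (Submodule.Quotient.mk_eq_zero N).2 w.1.2
  exact h

theorem concMap_shortExact (N : Submodule (𝒜 0) W) (m : ℤ) :
    (ShortComplex.mk _ _ (concMap_subtype_mkQ N m)).ShortExact := by
  refine shortExact_of_components _ (fun j (w w' : concComp N m j) h => ?_)
    (fun j (w : concComp (W ⧸ N) m j) => ?_) (fun j (w : concComp W m j) hw => ?_)
  · have h' : N.subtype w.1 = N.subtype w'.1 :=
      congrArg (fun z : concComp W m j => z.1) h
    exact Subtype.ext (Subtype.ext h')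
  · by_cases hj : j = m
    · obtain ⟨w', hw'⟩ := N.mkQ_surjective w.1
      exact ⟨⟨w', fun h => (h hj).elim⟩, Subtype.ext hw'⟩
    · refine ⟨0, Subtype.ext ?_⟩
      rw [w.2 hj]
      exact congrArg Subtype.val (map_zero ((concMap (W' := W ⧸ N) N.mkQ m).app j))
  · have hw' : N.mkQ w.1 = 0 := congrArg (fun z : concComp (W ⧸ N) m j => z.1) hw
    have hN : w.1 ∈ N := (Submodule.Quotient.mk_eq_zero N).1 hw'
    exact ⟨⟨⟨w.1, hN⟩, fun h => Subtype.ext (w.2 h)⟩, rfl⟩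

theorem isZero_conc [Subsingleton W] (m : ℤ) : IsZero (conc 𝒜 W m) :=
  isZero_of_subsingleton fun _ => ⟨fun _ _ => Subtype.ext (Subsingleton.elim _ _)⟩

/-- The inclusion of the component of highest degree. -/
def topInclusion (N : GrMod.{v, u} 𝒜) (c : ℤ) (hN : ∀ j > c, Subsingleton (N.comp j)) :
    conc 𝒜 (N.comp c) c ⟶ N where
  app j :=
    if hj : j = c then
      -- Acting by `1` serves as the transport from degree `c` to the equal degree `j`.
      (N.act 0 c j (by simp [hj]) ⟨1, SetLike.GradedOne.one_mem⟩).comp (AddSubgroup.subtype _)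
    else 0
  map_act i j l h a w := by
    by_cases hj : j = c
    · subst hj
      by_cases hi : i = 0
      · subst hi
        obtain rfl : j = l := by simpa using h
        simp only [dite_true]
        change N.act 0 j j _ _ (N.act 0 j j _ (projZeroRingHom' 𝒜 (a : A)) w.1) =
          N.act 0 j j _ a (N.act 0 j j _ _ w.1)
        rw [N.one_act, N.one_act, projZeroRingHom'_apply_coe]
      -- Positive degrees of `A` push the top component into zero.
      · exact (hN l (by omega)).elim _ _
    · rw [show w = 0 from Subtype.ext (w.2 hj)]
      simp

theorem topInclusion_app_coe (N : GrMod.{v, u} 𝒜) (c : ℤ)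
    (hN : ∀ j > c, Subsingleton (N.comp j)) (w : (conc 𝒜 (N.comp c) c).comp c) :
    (topInclusion N c hN).app c w = w.1 := by
  simp only [topInclusion, dite_true]
  exact N.one_act c w.1

theorem topInclusion_injective (N : GrMod.{v, u} 𝒜) (c : ℤ)
    (hN : ∀ j > c, Subsingleton (N.comp j)) (j : ℤ) :
    Function.Injective ((topInclusion N c hN).app j) := by
  intro w w' h
  by_cases hj : j = c
  · subst hj
    rw [topInclusion_app_coe, topInclusion_app_coe] at h
    exact Subtype.ext h
  · exact Subtype.ext ((w.2 hj).trans (w'.2 hj).symm)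

theorem topInclusion_surjective (N : GrMod.{v, u} 𝒜) (c : ℤ)
    (hN : ∀ j > c, Subsingleton (N.comp j)) : Function.Surjective ((topInclusion N c hN).app c) :=
  fun x => ⟨⟨x, fun h => (h rfl).elim⟩, topInclusion_app_coe N c hN _⟩

end Concentrated

/-! ### The graded radical and the structure of `S` -/

section Jacobson

open GradedRing

variable (𝒜) in
theorem isHomogeneous_comap_projZero (K : Ideal (𝒜 0)) :
    (K.comap (projZeroRingHom' 𝒜)).IsHomogeneous 𝒜 := by
  intro i x hx
  rw [Ideal.mem_comap] at hx ⊢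
  by_cases hi : i = 0
  · subst hi
    have : projZeroRingHom' 𝒜 (DirectSum.decompose 𝒜 x 0 : A) = projZeroRingHom' 𝒜 x := by
      rw [projZeroRingHom'_apply_coe]
      exact Subtype.ext (by simp [projZeroRingHom_apply])
    rwa [this]
  · rw [projZero_eq_zero hi]
    exact zero_mem _

variable (𝒜) in
theorem comap_projZero_ne_top {K : Ideal (𝒜 0)} (hK : K ≠ ⊤) :
    K.comap (projZeroRingHom' 𝒜) ≠ ⊤ := by
  rw [Ideal.ne_top_iff_one] at hK ⊢
  simpa using hK

/-- The degree zero part of a left ideal. -/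
def zeroPart (I : Ideal A) : Ideal (𝒜 0) where
  carrier := {a | (a : A) ∈ I}
  zero_mem' := I.zero_mem
  add_mem' := I.add_mem
  smul_mem' a _ hb := I.mul_mem_left (a : A) hb

theorem zeroPart_ne_top {I : Ideal A} (hI : I ≠ ⊤) : zeroPart (𝒜 := 𝒜) I ≠ ⊤ := by
  rw [Ideal.ne_top_iff_one] at hI ⊢
  exact hI

/-- A homogeneous left ideal `I` is contained in the homogeneous left ideal `I_0 ⊕ A_{≥ 1}`. -/
theorem le_comap_zeroPart {I : Ideal A} (hI : I.IsHomogeneous 𝒜) :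
    I ≤ (zeroPart (𝒜 := 𝒜) I).comap (projZeroRingHom' 𝒜) :=
  fun _ hx => hI 0 hx

theorem le_zeroPart {I : Ideal A} {K : Ideal (𝒜 0)} (h : K.comap (projZeroRingHom' 𝒜) ≤ I) :
    K ≤ zeroPart I := fun a ha => h (by
  rw [Ideal.mem_comap, projZeroRingHom'_apply_coe]
  exact ha)

variable (𝒜) in
/-- The graded Jacobson radical is `J_0 ⊕ A_{≥ 1}`, with `J_0` the Jacobson radical of `A_0`. -/
theorem gradedJacobson_eq_comap :
    gradedJacobson 𝒜 = (Ring.jacobson (𝒜 0)).comap (projZeroRingHom' 𝒜) := by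
  rw [Ring.jacobson_eq_sInf_isMaximal]
  apply le_antisymm
  · intro x hx
    rw [Ideal.mem_comap, Submodule.mem_sInf]
    intro (K : Ideal (𝒜 0)) (hK : K.IsMaximal)
    -- For maximal `K`, a proper homogeneous `I` above `K ⊕ A_{≥ 1}` has `I_0 = K`, hence lies in `K
    -- ⊕ A_{≥ 1}`.
    refine (Submodule.mem_sInf.1 hx) (K.comap (projZeroRingHom' 𝒜))
      ⟨⟨isHomogeneous_comap_projZero 𝒜 K, comap_projZero_ne_top 𝒜 hK.ne_top⟩, fun I hI hle => ?_⟩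
    rw [hK.eq_of_le (zeroPart_ne_top hI.2) (le_zeroPart hle)]
    exact le_comap_zeroPart hI.1
  · refine le_sInf fun I hI => ?_
    replace hI : Maximal (fun I' : Ideal A => I'.IsHomogeneous 𝒜 ∧ I' ≠ ⊤) I := hI
    intro x hx
    have hI0 := zeroPart_ne_top (𝒜 := 𝒜) hI.prop.2
    -- Conversely, maximality forces `I = I_0 ⊕ A_{≥ 1}`, and then `I_0` is maximal.
    have heq : I = (zeroPart (𝒜 := 𝒜) I).comap (projZeroRingHom' 𝒜) :=
      hI.eq_of_le ⟨isHomogeneous_comap_projZero 𝒜 _, comap_projZero_ne_top 𝒜 hI0⟩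
        (le_comap_zeroPart hI.prop.1)
    have hmax : (zeroPart (𝒜 := 𝒜) I).IsMaximal := by
      refine ⟨hI0, fun K hK => by_contra fun hKtop => hK.not_ge ?_⟩
      have h1 := hI.eq_of_le ⟨isHomogeneous_comap_projZero 𝒜 K, comap_projZero_ne_top 𝒜 hKtop⟩
        (heq.le.trans (Ideal.comap_mono hK.le))
      exact le_zeroPart h1.ge
    rw [heq, Ideal.mem_comap]
    exact Submodule.mem_sInf.1 hx _ hmax

variable (𝒜) in
/-- The map `A / J → A_0 / J_0`. -/
def quotientJacobsonMap :
    (A ⧸ gradedJacobson 𝒜) →ₛₗ[projZeroRingHom' 𝒜] (𝒜 0 ⧸ Ring.jacobson (𝒜 0)) :=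
  Submodule.mapQ _ _ (projZeroRingHom' 𝒜).toSemilinearMap (gradedJacobson_eq_comap 𝒜).le

theorem quotientJacobsonMap_injective : Function.Injective (quotientJacobsonMap 𝒜) := by
  rw [injective_iff_map_eq_zero]
  intro x hx
  induction x using Submodule.Quotient.induction_on with
  | H a =>
    refine (Submodule.Quotient.mk_eq_zero _).2 ?_
    rw [gradedJacobson_eq_comap]
    exact (Submodule.Quotient.mk_eq_zero (Ring.jacobson (𝒜 0))
      (x := projZeroRingHom' 𝒜 a)).1 hx

theorem projZero_of_mem_intGrading {j : ℤ} (hj : j ≠ 0) {a : A} (ha : a ∈ intGrading 𝒜 j) :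
    projZeroRingHom' 𝒜 a = 0 := by
  match j, ha with
  | Int.ofNat n, ha => exact projZero_eq_zero (by rintro rfl; exact hj rfl) (⟨a, ha⟩ : 𝒜 n)
  | Int.negSucc n, ha =>
    obtain rfl : a = 0 := ha
    exact map_zero _

variable (𝒜) in
/-- The comparison of `S(q)` with `A_0 / J_0` in degree `-q`. -/
def twistSemisimpleQuotientHom (q m : ℤ) (hm : q + m = 0) :
    (semisimpleQuotient 𝒜).twist q ⟶ conc 𝒜 (𝒜 0 ⧸ Ring.jacobson (𝒜 0)) m where
  app j := ((quotientJacobsonMap 𝒜).toAddMonoidHom.comp (AddSubgroup.subtype _)).codRestrict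
    (concComp (𝒜 0 ⧸ Ring.jacobson (𝒜 0)) m j) (by
      rintro ⟨_, a, ha, rfl⟩ hj
      change Submodule.Quotient.mk (projZeroRingHom' 𝒜 a) = _
      rw [projZero_of_mem_intGrading (by omega) ha]
      rfl)
  map_act _ _ _ _ a x := Subtype.ext ((quotientJacobsonMap 𝒜).map_smulₛₗ (a : A) x.1)

/-- `J` contains `A_{≥ 1}`, so only `A_0 / J_0` survives in `S`. -/
instance isIso_twistSemisimpleQuotientHom (q m : ℤ) (hm : q + m = 0) :
    IsIso (twistSemisimpleQuotientHom 𝒜 q m hm) := by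
  refine isIso_of_bijective _ fun j => ⟨fun x y hxy => ?_, fun w => ?_⟩
  · exact Subtype.ext (quotientJacobsonMap_injective (congrArg Subtype.val hxy))
  · by_cases hj : j = m
    · obtain ⟨b, hb⟩ := Submodule.Quotient.mk_surjective _ w.1
      have hb' : (b : A) ∈ intGrading 𝒜 (j + q) := by
        rw [show j + q = 0 by omega]
        exact b.2
      refine ⟨⟨_, (b : A), hb', rfl⟩, Subtype.ext ?_⟩
      rw [← hb]
      exact congrArg Submodule.Quotient.mk (projZeroRingHom'_apply_coe 𝒜 b)
    · refine ⟨0, Subtype.ext ?_⟩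
      rw [w.2 hj, map_zero]
      rfl

theorem subsingleton_twist_semisimpleQuotient (q j : ℤ) (h : q + j ≠ 0) :
    Subsingleton (((semisimpleQuotient 𝒜).twist q).comp j) :=
  ⟨fun x y => injective_of_mono (twistSemisimpleQuotientHom 𝒜 q (-q) (by omega)) j
    (Subtype.ext ((((twistSemisimpleQuotientHom 𝒜 q (-q) (by omega)).app j x).2 (by omega)).trans
      (((twistSemisimpleQuotientHom 𝒜 q (-q) (by omega)).app j y).2 (by omega)).symm))⟩

/-- A simple module over an artinian ring is a direct summand of the quotient by the radical. -/
theorem exists_retract_of_isSimpleModule (R : Type*) [Ring R] [IsArtinianRing R] (L : Type*)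
    [AddCommGroup L] [Module R L] [IsSimpleModule R L] :
    ∃ (i : L →ₗ[R] R ⧸ Ring.jacobson R) (r : (R ⧸ Ring.jacobson R) →ₗ[R] L),
      r ∘ₗ i = LinearMap.id := by
  obtain ⟨I, hI, ⟨e⟩⟩ := isSimpleModule_iff_quot_maximal.1 (inferInstance : IsSimpleModule R L)
  have hle : Ring.jacobson R ≤ I := by
    rw [Ring.jacobson_eq_sInf_isMaximal]
    exact sInf_le hI
  have : IsSemisimpleModule R (R ⧸ Ring.jacobson R) :=
    (IsArtinian.isSemisimpleModule_iff_jacobson R _).2 (Module.jacobson_quotient_jacobson R R)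
  -- `L` is a quotient of the semisimple module `R / J(R)`, so the surjection splits.
  let r : (R ⧸ Ring.jacobson R) →ₗ[R] L := e.symm.toLinearMap ∘ₗ Submodule.factor hle
  obtain ⟨i, hi⟩ := IsSemisimpleModule.lifting_property r
    (e.symm.surjective.comp (Submodule.factor_surjective hle)) LinearMap.id
  exact ⟨i, r, hi⟩

end Jacobson

/-! ### Dévissage of modules with components of finite length -/

section FiniteLength

open DerivedCategory

theorem isFiniteLength_coker {M N : GrMod.{v, u} 𝒜} (f : M ⟶ N) (j : ℤ)
    (h : IsFiniteLength (𝒜 0) (N.comp j)) : IsFiniteLength (𝒜 0) ((coker f).comp j) :=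
  h.of_surjective (f :=
    { toFun := (cokerπ f).app j
      map_add' := map_add _
      map_smul' := hom_map_smul (cokerπ f) j }) (QuotientAddGroup.mk'_surjective _)

variable [HasDerivedCategory.{w} (GrMod.{v, u} 𝒜)] [IsArtinianRing (𝒜 0)]

/-- Induction along a composition series: a simple factor placed in degree `m` is a retract of
`S(-m)`. -/
theorem homSingleVanishes_conc (X : DerivedCategory (GrMod.{v, u} 𝒜)) (n m : ℤ)
    (hS : HomSingleVanishes X ((semisimpleQuotient 𝒜).twist (-m)) n)
    (W : Type u) [AddCommGroup W] [Module (𝒜 0) W] (hW : IsFiniteLength (𝒜 0) W) :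
    HomSingleVanishes X (conc 𝒜 W m) n := by
  induction hW with
  | of_subsingleton => exact homSingleVanishes_of_isZero X (isZero_conc m) n
  | @of_simple_quotient W _ _ N _ _ ih =>
    refine HomSingleVanishes.middle (concMap_shortExact N m) ih ?_
    obtain ⟨i, r, hir⟩ := exists_retract_of_isSimpleModule (𝒜 0) (W ⧸ N)
    let t := twistSemisimpleQuotientHom 𝒜 (-m) m (by omega)
    have h1 := hS.of_retract (inv t) t (by simp)
    refine h1.of_retract (concMap i m) (concMap r m) (hom_ext fun j w => Subtype.ext ?_)
    exact LinearMap.congr_fun hir w.1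

/-- Strip off top components one degree at a time from `c` down to `b`; `hb` handles what remains,
so `N` need not be bounded below. -/
theorem homSingleVanishes_of_isFiniteLength (X : DerivedCategory (GrMod.{v, u} 𝒜)) (n b c : ℤ)
    (hb : ∀ N : GrMod.{v, u} 𝒜, (∀ j > b, Subsingleton (N.comp j)) → HomSingleVanishes X N n)
    (hS : ∀ m ≤ c, HomSingleVanishes X ((semisimpleQuotient 𝒜).twist (-m)) n)
    (N : GrMod.{v, u} 𝒜) (hN : ∀ j, IsFiniteLength (𝒜 0) (N.comp j))
    (hNc : ∀ j > c, Subsingleton (N.comp j)) : HomSingleVanishes X N n := by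
  obtain ⟨d, hd⟩ : ∃ d : ℕ, c ≤ b + d := ⟨(c - b).toNat, by omega⟩
  induction d generalizing c N with
  | zero => exact hb N fun j hj => hNc j (by simp only [Nat.cast_zero] at hd; omega)
  | succ d ih =>
    refine HomSingleVanishes.middle
      (shortExact_cokerπ (topInclusion N c hNc) (topInclusion_injective N c hNc))
      (homSingleVanishes_conc X n c (hS c le_rfl) _ (hN c))
      (ih (c - 1) (fun m hm => hS m (by omega)) _ (fun j => isFiniteLength_coker _ j (hN j))
        (fun j hj => ?_) (by push_cast at hd; omega))
    by_cases hjc : j = c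
    · subst hjc
      exact subsingleton_coker _ (topInclusion_surjective N j hNc)
    · have := hNc j (by omega)
      exact subsingleton_coker _ fun y => ⟨0, Subsingleton.elim _ _⟩

end FiniteLength

end GrMod

namespace GrMod

/-- The component of degree `j` of the graded vector space given by `W` in degree `m`. -/
abbrev singleComp (k W : Type*) [Field k] [AddCommGroup W] [Module k W] (m j : ℤ) :
    Submodule k W := if j = m then ⊤ else ⊥

theorem subsingleton_singleComp {k W : Type*} [Field k] [AddCommGroup W] [Module k W] {m j : ℤ}
    (h : j ≠ m) : Subsingleton (singleComp k W m j) := by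
  rw [singleComp, if_neg h]
  infer_instance

theorem isNoetherian_linearMap (k V W : Type*) [Field k] [AddCommGroup V] [Module k V]
    [AddCommGroup W] [Module k W] [Module.Finite k V] [Module.Finite k W] :
    IsNoetherian k (V →ₗ[k] W) :=
  inferInstance

variable {k : Type v} [Field k] {A : Type u} [Ring A] [Algebra k A]
  {𝒜 : ℕ → Submodule k A} [GradedAlgebra 𝒜]

/-! ### The graded dual as a test object -/

section Dual

/-- Degree `j` embeds in `Hom_k(A_{m-j}, A_0)`, which is finite-dimensional over `k`. The
coefficient space is `A_0` rather than `k` because components must lie in the universe of `A`. -/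
theorem isFiniteLength_coind (hfin : ∀ i, Module.Finite k (𝒜 i)) (m j : ℤ) :
    IsFiniteLength (𝒜 0) ((coind (algebraMap k (𝒜 0)) (fun j => singleComp k (𝒜 0) m j)).comp j) := by
  by_cases hj : m < j
  · have := subsingleton_coind_comp (algebraMap k (𝒜 0)) (V := fun j => singleComp k (𝒜 0) m j) (c := m)
      (fun j hj => subsingleton_singleComp hj.ne') hj
    exact .of_subsingleton
  · obtain ⟨i, hi⟩ : ∃ i : ℕ, (i : ℤ) + j = m := ⟨(m - j).toNat, by omega⟩
    let := compRestrict (algebraMap k (𝒜 0)) (coind (algebraMap k (𝒜 0)) (fun j => singleComp k (𝒜 0) m j)) j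
    have : IsScalarTower k (𝒜 0) ((coind (algebraMap k (𝒜 0)) (fun j => singleComp k (𝒜 0) m j)).comp j) :=
      ⟨fun r a f => by
        have h : r • a = algebraMap k (𝒜 0) r * a := Algebra.smul_def r a
        rw [h, mul_smul]
        rfl⟩
    let e : (coind (algebraMap k (𝒜 0)) (fun j => singleComp k (𝒜 0) m j)).comp j →ₗ[k]
        (𝒜 i →ₗ[k] singleComp k (𝒜 0) m m) :=
      { toFun := fun f =>
          { toFun := f.1 ⟨(i, m), hi⟩
            map_add' := map_add _
            map_smul' := fun r b => f.2 ⟨(i, m), hi⟩ r b (r • b) (Algebra.smul_def r (b : A)) }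
        map_add' := fun _ _ => rfl
        -- Scalars act on families by right multiplication on the argument; centrality of `k` turns
        -- it into left multiplication.
        map_smul' := fun r f => LinearMap.ext fun b => by
          refine Eq.trans ?_ (f.2 ⟨(i, m), hi⟩ r b (r • b) (Algebra.smul_def r (b : A)))
          exact coindComp_eq_of_eq (φ := algebraMap k (𝒜 0))
            (V := fun j => singleComp k (𝒜 0) m j) f (b := mulRight (algebraMap k (𝒜 0) r) i b) (b' := r • b) _ _
            ((Algebra.commutes r (b : A)).symm.trans (Algebra.smul_def r (b : A)).symm) }
    have he : Function.Injective e := fun f g hfg => by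
      refine Subtype.ext (funext fun t => AddMonoidHom.ext fun b => ?_)
      obtain ⟨⟨i', l⟩, ht⟩ := t
      by_cases hl : l = m
      · subst hl
        obtain rfl : i' = i := by simp only at ht; omega
        exact LinearMap.congr_fun hfg b
      · exact (subsingleton_singleComp hl).elim _ _
    have hz : Module.Finite k (singleComp k (𝒜 0) m m) := inferInstance
    have hh : IsNoetherian k (𝒜 i →ₗ[k] singleComp k (𝒜 0) m m) :=
      isNoetherian_linearMap k (𝒜 i) (singleComp k (𝒜 0) m m)
    have := Module.Finite.of_injective e he
    rw [isFiniteLength_iff_isNoetherian_isArtinian]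
    exact ⟨isNoetherian_of_tower k inferInstance, isArtinian_of_tower k inferInstance⟩

/-- A nonzero element of `M_m` is seen by a `k`-linear functional, which coinduction extends to a
graded homomorphism. -/
theorem subsingleton_comp_of_hom_coind_eq_zero (M : GrMod.{v, u} 𝒜) (m : ℤ)
    (h : ∀ f : M ⟶ coind (algebraMap k (𝒜 0)) (fun j => singleComp k (𝒜 0) m j), f = 0) :
    Subsingleton (M.comp m) := by
  let := compRestrict (algebraMap k (𝒜 0)) M
  by_contra hM
  rw [not_subsingleton_iff_nontrivial] at hM
  have hA : Nontrivial (𝒜 0) := by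
    by_contra hA
    rw [not_nontrivial_iff_subsingleton] at hA
    have := Module.subsingleton (𝒜 0) (M.comp m)
    exact not_subsingleton (M.comp m) this
  obtain ⟨x, hx⟩ := exists_ne (0 : M.comp m)
  obtain ⟨f, hf⟩ : ∃ f : M.comp m →ₗ[k] k, f x ≠ 0 := by
    by_contra hf
    push Not at hf
    exact hx ((Module.forall_dual_apply_eq_zero_iff k x).1 hf)
  -- `o` turns a functional into a map to `A_0`; it is nonzero because `A_0` acts unitally on `M_m ≠
  -- 0`.
  let o : singleComp k (𝒜 0) m m := ⟨1, by simp [singleComp]⟩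
  have ho : o ≠ 0 := fun h => one_ne_zero (congrArg Subtype.val h)
  let g : ∀ j, M.comp j →ₗ[k] singleComp k (𝒜 0) m j := Pi.single m (f.smulRight o)
  have hg : ∀ j (r : k) (y : M.comp j),
      (g j).toAddMonoidHom (algebraMap k (𝒜 0) r • y) = r • (g j).toAddMonoidHom y :=
    fun j r y => map_smul (g j) r y
  have h1 := coindEval_toCoind (algebraMap k (𝒜 0)) (V := fun j => singleComp k (𝒜 0) m j)
    (fun j => (g j).toAddMonoidHom) hg m x
  rw [h (toCoind _ _ hg)] at h1
  have h2 : g m x = 0 := h1.symm.trans (map_zero _)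
  rw [show g m = f.smulRight o from Pi.single_eq_same _ _] at h2
  exact (smul_ne_zero hf ho) h2

end Dual

/-! ### Degree bounds and the two vanishing statements -/

theorem IsFG.exists_bound {M : GrMod.{v, u} 𝒜} (hM : M.IsFG) :
    ∃ b : ℤ, ∀ j ≤ b, Subsingleton (M.comp j) := by
  obtain ⟨n, d, x, h⟩ := hM
  obtain ⟨b, hb⟩ := (Set.finite_range d).bddBelow
  refine ⟨b - 1, fun j hj => ?_⟩
  have h0 : ∀ y : M.comp j, y = 0 := fun y => by
    have hy := h j y
    rwa [show {z : M.comp j | ∃ (t : Fin n) (i : ℕ) (h : (i : ℤ) + d t = j) (a : 𝒜 i),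
        z = M.act i (d t) j h a (x t)} = ∅ from Set.eq_empty_of_forall_notMem (by
      rintro z ⟨t, i, hi, -⟩
      have := hb ⟨t, rfl⟩
      omega), AddSubgroup.closure_empty, AddSubgroup.mem_bot] at hy
  exact ⟨fun y z => (h0 y).trans (h0 z).symm⟩

theorem subsingleton_comp_of_isZero {M : GrMod.{v, u} 𝒜} (hM : IsZero M) (j : ℤ) :
    Subsingleton (M.comp j) := by
  have h0 : ∀ y : M.comp j, y = 0 := fun y =>
    congrArg (fun t : M ⟶ M => t.app j y) (hM.eq_of_src (𝟙 M) 0)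
  exact ⟨fun y z => (h0 y).trans (h0 z).symm⟩

variable [HasDerivedCategory.{w} (GrMod.{v, u} 𝒜)]

/-- Only the finitely many cohomologies between `n` and the top one matter, which makes the bound
uniform. -/
theorem IsDMinusFG.exists_bound {X : DerivedCategory (GrMod.{v, u} 𝒜)} (hX : IsDMinusFG X)
    (n : ℤ) : ∃ b : ℤ, ∀ i ≥ n, ∀ j ≤ b, Subsingleton (cohomology X i j) := by
  obtain ⟨m, hm⟩ := hX.1
  choose b hb using fun i => (hX.2 i).exists_bound
  obtain ⟨c, hc⟩ := ((Set.finite_Icc n m).image b).bddBelow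
  refine ⟨c, fun i hi j hj => ?_⟩
  by_cases him : i ≤ m
  · exact hb i j (hj.trans (hc ⟨i, ⟨hi, him⟩, rfl⟩))
  · exact subsingleton_comp_of_isZero (hm i (by omega)) j

/-- If `Ext^p(X, S)_q` vanishes for all `q ≥ -j`, with `p = -i`, then `H^i(X)_j = 0`. -/
theorem subsingleton_cohomology_of_gExt (hfin : ∀ i, Module.Finite k (𝒜 i))
    {X : DerivedCategory (GrMod.{v, u} 𝒜)} (hX : IsDMinusFG X) (i j : ℤ)
    (h : ∀ q ≥ -j, Subsingleton (gExt X (semisimpleQuotient 𝒜) (-i) q)) :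
    Subsingleton (cohomology X i j) := by
  have : IsScalarTower k (𝒜 0) (𝒜 0) :=
    ⟨fun r a b => Subtype.ext (smul_mul_assoc r (a : A) (b : A))⟩
  have : IsArtinianRing (𝒜 0) := isArtinian_of_tower k inferInstance
  obtain ⟨b, hb⟩ := hX.exists_bound i
  -- Test `H^i(X)_j` against the dual with top degree `j`; its layers in degrees `m ≤ j` only need
  -- `S(-m)`, that is `q = -m ≥ -j`.
  refine subsingleton_comp_of_hom_coind_eq_zero _ j fun f =>
    DerivedCategory.HomSingleVanishes.homology_eq_zero ?_ f
  refine homSingleVanishes_of_isFiniteLength X i b j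
    (homSingleVanishes_of_le X hX.1 i b hb) (fun m hm => ?_) _ (isFiniteLength_coind hfin j)
    (fun l hl => subsingleton_coind_comp _ (c := j) (fun l hl => subsingleton_singleComp hl.ne') hl)
  have := (DerivedCategory.homSingleVanishes_neg_iff X ((semisimpleQuotient 𝒜).twist (-m)) (-i)).2
    (h (-m) (by omega))
  rwa [neg_neg] at this

/-- `S(q)` lives in internal degree `-q` and is placed in complex degree `-p`: total degree `-(p +
q)`. The strict bound used is therefore one more. -/
theorem subsingleton_gExt_of_cohomology [IsSemisimpleRing (𝒜 0)]
    {X : DerivedCategory (GrMod.{v, u} 𝒜)} (hX : IsDMinusFG X) (p q : ℤ)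
    (h : ∀ i j, i + j ≤ -(p + q) → Subsingleton (cohomology X i j)) :
    Subsingleton (gExt X (semisimpleQuotient 𝒜) p q) := by
  refine (DerivedCategory.homSingleVanishes_neg_iff X _ p).1 ?_
  exact homSingleVanishes_of_add_lt (RingHom.id (𝒜 0)) Function.surjective_id X hX.1 (-p)
    (-(p + q) + 1) (fun i j hij => h i j (by omega)) _
    (fun j hj => subsingleton_twist_semisimpleQuotient q j (by omega))

end GrMod

end

theorem proposition3p12 {k : Type v} [Field k] {A : Type u} [Ring A] [Algebra k A]
    (𝒜 : ℕ → Submodule k A) [GradedAlgebra 𝒜] [IsNoetherianRing A]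
    (hfin : ∀ i, Module.Finite k (𝒜 i))
    [HasDerivedCategory.{w} (GrMod.{v, u} 𝒜)]
    (X : DerivedCategory (GrMod.{v, u} 𝒜)) (hX : GrMod.IsDMinusFG X) (hX0 : ¬ IsZero X) :
    -GrMod.ideg X ≤ GrMod.extreg X ∧
      (IsSemisimpleRing (𝒜 0) → GrMod.extreg X = -GrMod.ideg X) := by
  have key : -GrMod.ideg X ≤ GrMod.extreg X := by
    rw [EReal.neg_le]
    refine le_sInf ?_
    rintro _ ⟨i, j, hij, rfl⟩
    rw [EReal.neg_le]
    by_contra hlt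
    rw [not_le] at hlt
    refine not_subsingleton_iff_nontrivial.2 hij
      (GrMod.subsingleton_cohomology_of_gExt hfin hX i j fun q hq => ?_)
    by_contra hnt
    rw [not_subsingleton_iff_nontrivial] at hnt
    -- A nonzero `Ext^{-i}(X, S)_q` with `q ≥ -j` would force `extreg X ≥ -(i + j)`.
    have h1 : (((-i + q : ℤ) : ℝ) : EReal) ≤ GrMod.extreg X := le_sSup ⟨-i, q, hnt, rfl⟩
    have h2 := h1.trans_lt hlt
    rw [← EReal.coe_neg, EReal.coe_lt_coe_iff] at h2
    norm_cast at h2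
    omega
  refine ⟨key, fun hss => le_antisymm (sSup_le ?_) key⟩
  rintro _ ⟨p, q, hpq, rfl⟩
  rw [EReal.le_neg]
  by_contra hlt
  rw [not_le] at hlt
  refine not_subsingleton_iff_nontrivial.2 hpq
    (GrMod.subsingleton_gExt_of_cohomology hX p q fun i j hij => ?_)
  by_contra hnt
  rw [not_subsingleton_iff_nontrivial] at hnt
  have h1 : GrMod.ideg X ≤ (((i + j : ℤ) : ℝ) : EReal) := sInf_le ⟨i, j, hnt, rfl⟩
  have h2 := hlt.trans_le h1
  rw [← EReal.coe_neg, EReal.coe_lt_coe_iff] at h2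
  norm_cast at h2
  omega
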